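/- Let $G$ be a discrete abelian group (written additively), $\widehat G$ its compact dual group with Haar measure normalized to total mass $1$, and write $\langle g,\xi\rangle=\xi(g)$ for $g\in G$, $\xi\in\widehat G$. For $x\in\ell^2(G)$ let $\widehat x\in L^2(\widehat G)$ denote its Fourier transform, i.e. the continuous extension to $\ell^2(G)$ (isometric onto $L^2(\widehat G)$) of $x\mapsto\sum_{g\in G}x(g)\langle -g,\cdot\rangle$. Let $\mathcal H$ be a separable complex Hilbert space with inner product linear in the first variable, $\pi$ a homomorphism from $G$ to the group of unitary operators of $\mathcal H$, $N\ge 1$, and $\varphi_1,\dots,\varphi_N\in\mathcal H$. Let $\ell^2_N(G)$ be the product of $N$ copies of $\ell^2(G)$, with $\|\mathbf x\|^2=\sum_{n=1}^N\|x_n\|^2$. The system $\{\pi_g\varphi_n\}_{1\le n\le N,\,g\in G}$ is a *Bessel sequence* with Bessel bound $\beta\in\mathbb R$ if for every $\mathbf x=(x_1,\dots,x_N)\in\ell^2_N(G)$ the series $\sum_{n,g}x_n(g)\,\pi_g\varphi_n$ converges unconditionally in $\mathcal H$ and $\big\|\sum_{n,g}x_n(g)\,\pi_g\varphi_n\big\|^2\le\beta\|\mathbf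 x\|^2$. It is a *Riesz sequence* with Riesz bounds $0<\alpha\le\beta<\infty$ if for every $\mathbf x\in\ell^2_N(G)$ this series converges unconditionally and $$\alpha\|\mathbf x\|^2\le\Big\|\sum_{n,g}x_n(g)\,\pi_g\varphi_n\Big\|^2\le\beta\|\mathbf x\|^2 .$$ The optimal Bessel bound is the smallest Bessel bound $\beta$; the optimal Riesz bounds are the largest $\alpha$ and the smallest $\beta$ that occur in pairs of Riesz bounds. Let $a_{m,n}(g)=\langle\varphi_n,\pi_g\varphi_m\rangle_{\mathcal H}$ for $1\le m,n\le N$, $g\in G$, and assume that $a_{m,n}\in\ell^2(G)$ for all $m,n$. Let $\mathcal G=[\,\widehat{a_{m,n}}\,]^\top$ be the Gram matrix, an $N\times N$ matrix with entries in $L^2(\widehat G)$. For a positive semidefinite matrix $C$ let $\lambda_{\min}[C]$, $\lambda_{\max}[C]$ denote its smallest and largest eigenvalues. Then: (a) The system $\{\pi_g\varphi_n\}$ is a Bessel sequence if and only if all entries of $\mathcal G$ are in $L^\infty(\widehat G)$. In this case the matrix $\mathcal G(\xi)$ is positive semidefinite for a.e. $\xi\in\widehat G$, and the optimal Bessel bound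 is $\operatorname{ess\,sup}_{\xi\in\widehat G}\lambda_{\max}[\mathcal G(\xi)]$. (b) The system $\{\pi_g\varphi_n\}$ is a Riesz sequence if and only if all entries of $\mathcal G$ are in $L^\infty(\widehat G)$ and $\operatorname{ess\,inf}_{\xi\in\widehat G}\det\mathcal G(\xi)>0$ (by (a), $\det\mathcal G(\xi)$ is real for a.e. $\xi$ when the entries of $\mathcal G$ are in $L^\infty(\widehat G)$). In this case the optimal Riesz bounds are $\operatorname{ess\,inf}_{\xi\in\widehat G}\lambda_{\min}[\mathcal G(\xi)]$ and $\operatorname{ess\,sup}_{\xi\in\widehat G}\lambda_{\max}[\mathcal G(\xi)]$. -/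

import Mathlib

open MeasureTheory
open scoped ComplexOrder ENNReal

noncomputable section

namespace GroupRiesz

section Fourier

variable {G : Type*} [AddCommGroup G] [TopologicalSpace G] [DiscreteTopology G]

/-- The dual group of the (additive) group `G`: the continuous characters of `G` with values in
the unit circle, with the compact-open topology. -/
abbrev Dual (G : Type*) [AddCommGroup G] [TopologicalSpace G] : Type _ :=
  PontryaginDual (Multiplicative G)

instance instMeasurableSpaceDual (G : Type*) [AddCommGroup G] [TopologicalSpace G] :
    MeasurableSpace (Dual G) := borel _

instance instBorelSpaceDual (G : Type*) [AddCommGroup G] [TopologicalSpace G] :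
    BorelSpace (Dual G) := ⟨rfl⟩

/-- The Haar measure of the compact group `Dual G`, normalized to have total mass one. -/
def haar (G : Type*) [AddCommGroup G] [TopologicalSpace G] [DiscreteTopology G] :
    Measure (Dual G) :=
  Measure.haarMeasure ⊤

instance : IsProbabilityMeasure (haar G) :=
  ⟨by
    have h := Measure.haarMeasure_self (K₀ := (⊤ : TopologicalSpace.PositiveCompacts (Dual G)))
    simpa [haar] using h⟩

instance : (haar G).IsHaarMeasure := by unfold haar; infer_instance

instance : (haar G).Regular := by unfold haar; infer_instance

/-- The pairing `⟨g, ξ⟩ = ξ(g)`, as a complex number of modulus one. -/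
def pairing (g : G) (ξ : Dual G) : ℂ := (ξ (Multiplicative.ofAdd g) : ℂ)

/-- The function `ξ ↦ ⟨-g, ξ⟩` on the dual group, as a continuous function. -/
def charFun (g : G) : C(Dual G, ℂ) where
  toFun ξ := pairing (-g) ξ
  continuous_toFun := by
    unfold pairing
    have h : Continuous fun ξ : (Multiplicative G →ₜ* Circle) => ξ (Multiplicative.ofAdd (-g)) :=
      (ContinuousEvalConst.continuous_eval_const (Multiplicative.ofAdd (-g)))
    exact continuous_subtype_val.comp h

/-- The function `ξ ↦ ⟨-g, ξ⟩` as an element of `L²` of the dual group. -/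
def charLp (g : G) : Lp ℂ 2 (haar G) := ContinuousMap.toLp 2 (haar G) ℂ (charFun g)

/-- Characters separate points. -/
theorem exists_pairing_ne_one {g : G} (hg : g ≠ 0) : ∃ ξ : Dual G, pairing g ξ ≠ 1 := by
  obtain ⟨c, hc⟩ := CharacterModule.exists_character_apply_ne_zero_of_ne_zero hg
  let f : ℚ →+ AddCircle (1 : ℝ) :=
    (QuotientAddGroup.mk' (AddSubgroup.zmultiples (1 : ℝ))).comp (Rat.castHom ℝ).toAddMonoidHom
  have hf : ∀ q : ℚ, f q = 0 ↔ (q : AddCircle (1 : ℚ)) = 0 := by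
    intro q
    have h1 : f q = ((q : ℝ) : AddCircle (1 : ℝ)) := rfl
    rw [h1, AddCircle.coe_eq_zero_iff, AddCircle.coe_eq_zero_iff]
    refine exists_congr fun n => ?_
    simp only [zsmul_eq_mul, mul_one]
    exact_mod_cast Iff.rfl
  let F : AddCircle (1 : ℚ) →+ AddCircle (1 : ℝ) :=
    QuotientAddGroup.lift _ f (by
      intro q hq
      exact (hf q).2 ((QuotientAddGroup.eq_zero_iff q).2 hq))
  have hF : ∀ x, F x = 0 → x = 0 := by
    intro x
    induction x using QuotientAddGroup.induction_on with
    | H q => exact fun h => (hf q).1 h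
  let ξ : Multiplicative G →ₜ* Circle :=
    { toFun := fun a => (F (c a.toAdd)).toCircle
      map_one' := by simp
      map_mul' := fun a b => by simp [AddCircle.toCircle_add]
      continuous_toFun := continuous_of_discreteTopology }
  refine ⟨ξ, fun h => hc (hF _ ?_)⟩
  have h2 : (F (c g)).toCircle = (0 : AddCircle (1 : ℝ)).toCircle := by
    rw [AddCircle.toCircle_zero]
    exact Subtype.ext h
  exact AddCircle.injective_toCircle one_ne_zero h2

theorem integral_pairing {g : G} (hg : g ≠ 0) : ∫ ξ, pairing g ξ ∂(haar G) = 0 := by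
  obtain ⟨η, hη⟩ := exists_pairing_ne_one hg
  have h1 := integral_mul_left_eq_self (μ := haar G) (fun ξ => pairing g ξ) η
  have h2 : ∀ ξ, pairing g (η * ξ) = pairing g η * pairing g ξ := fun ξ => Circle.coe_mul _ _
  simp_rw [h2] at h1
  rw [integral_const_mul] at h1
  have h3 : (pairing g η - 1) * ∫ ξ, pairing g ξ ∂(haar G) = 0 := by
    rw [sub_mul, h1, one_mul, sub_self]
  exact (mul_eq_zero.1 h3).resolve_left (sub_ne_zero.2 hη)

theorem orthonormal_charLp : Orthonormal ℂ (charLp (G := G)) := by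
  classical
  rw [orthonormal_iff_ite]
  intro g h
  have key : inner ℂ (charLp g) (charLp h) = ∫ ξ, pairing (g - h) ξ ∂(haar G) := by
    unfold charLp
    rw [ContinuousMap.inner_toLp]
    refine integral_congr_ae (Filter.Eventually.of_forall fun ξ => ?_)
    have e1 : (starRingEnd ℂ) (charFun g ξ) = pairing g ξ := by
      change (starRingEnd ℂ) ((ξ (Multiplicative.ofAdd (-g)) : Circle) : ℂ) = _
      rw [ofAdd_neg, map_inv, Circle.coe_inv_eq_conj, Complex.conj_conj]
      rfl
    have e2 : pairing (g - h) ξ = pairing g ξ * charFun h ξ := by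
      change ((ξ (Multiplicative.ofAdd (g - h)) : Circle) : ℂ) = _
      rw [sub_eq_add_neg, ofAdd_add, map_mul, Circle.coe_mul]
      rfl
    change charFun h ξ * (starRingEnd ℂ) (charFun g ξ) = _
    rw [e1, e2, mul_comm]
  rw [key]
  split_ifs with hgh
  · subst hgh
    have : ∀ ξ : Dual G, pairing (0 : G) ξ = 1 := fun ξ => by
      unfold pairing
      rw [ofAdd_zero, map_one, Circle.coe_one]
    simp [this]
  · exact integral_pairing (sub_ne_zero.2 hgh)

/-- The space `ℓ²(G)`. -/
abbrev ell2 (G : Type*) : Type _ := lp (fun _ : G => ℂ) 2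

/-- The Fourier transform `ℓ²(G) → L²(Ĝ)`: the linear isometry sending `x` to the sum
`∑ g, x g ⟨-g, ·⟩`, which converges unconditionally in `L²` because the functions `⟨-g, ·⟩` are
orthonormal. It is the unique continuous extension of
`x ↦ (ξ ↦ ∑ g, x g ⟨-g, ξ⟩)` from the (finitely supported or summable) sequences. -/
def fourierL2 : ell2 G →ₗᵢ[ℂ] Lp ℂ 2 (haar G) :=
  (orthonormal_charLp (G := G)).orthogonalFamily.linearIsometry

end Fourier

/-- The Hilbert space `ℓ²_N(G)`, the product of `N` copies of `ℓ²(G)`, with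
`‖x‖² = ∑ n, ‖x n‖²`. -/
abbrev ell2N (N : ℕ) (G : Type*) : Type _ := PiLp 2 (fun _ : Fin N => ell2 G)

section Systems

variable {G : Type*} [AddCommGroup G] {H : Type*} [NormedAddCommGroup H] [InnerProductSpace ℂ H]

/-- The entries `x n g • π g (φ n)` of the series generated by the system `{π g (φ n)}` and a
sequence of coefficients. -/
def synthTerm (π : Multiplicative G →* (H ≃ₗᵢ[ℂ] H)) {N : ℕ} (φ : Fin N → H) (x : ell2N N G)
    (p : Fin N × G) : H :=
  x p.1 p.2 • π (Multiplicative.ofAdd p.2) (φ p.1)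

/-- `β` is a Bessel bound of the system `{π g (φ n)}`: for every `x` in `ℓ²_N(G)` the series
`∑ x n g • π g (φ n)` converges and its squared norm is at most `β ‖x‖²`. -/
def IsBesselBound (π : Multiplicative G →* (H ≃ₗᵢ[ℂ] H)) {N : ℕ} (φ : Fin N → H) (β : ℝ) :
    Prop :=
  ∀ x : ell2N N G, Summable (synthTerm π φ x) ∧ ‖∑' p, synthTerm π φ x p‖ ^ 2 ≤ β * ‖x‖ ^ 2

/-- The system `{π g (φ n)}` is a Bessel sequence. -/
def IsBesselSequence (π : Multiplicative G →* (H ≃ₗᵢ[ℂ] H)) {N : ℕ} (φ : Fin N → H) : Prop :=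
  ∃ β : ℝ, IsBesselBound π φ β

/-- `0 < α ≤ β < ∞` are Riesz bounds of the system `{π g (φ n)}`. -/
def AreRieszBounds (π : Multiplicative G →* (H ≃ₗᵢ[ℂ] H)) {N : ℕ} (φ : Fin N → H) (α β : ℝ) :
    Prop :=
  0 < α ∧ α ≤ β ∧ ∀ x : ell2N N G, Summable (synthTerm π φ x) ∧
    α * ‖x‖ ^ 2 ≤ ‖∑' p, synthTerm π φ x p‖ ^ 2 ∧ ‖∑' p, synthTerm π φ x p‖ ^ 2 ≤ β * ‖x‖ ^ 2

/-- The system `{π g (φ n)}` is a Riesz sequence. -/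
def IsRieszSequence (π : Multiplicative G →* (H ≃ₗᵢ[ℂ] H)) {N : ℕ} (φ : Fin N → H) : Prop :=
  ∃ α β : ℝ, AreRieszBounds π φ α β

/-- The functions `a m n g = ⟨φ n, π g (φ m)⟩`, with the scalar product linear in the first
variable (Mathlib's `inner` is linear in the second one). -/
def corr (π : Multiplicative G →* (H ≃ₗᵢ[ℂ] H)) {N : ℕ} (φ : Fin N → H) (m n : Fin N) (g : G) :
    ℂ :=
  inner ℂ (π (Multiplicative.ofAdd g) (φ m)) (φ n)

/-- The matrix `A = [a m n]` has all its entries in `ℓ²(G)`. -/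
def CorrMemEll2 (π : Multiplicative G →* (H ≃ₗᵢ[ℂ] H)) {N : ℕ} (φ : Fin N → H) : Prop :=
  ∀ m n, Memℓp (corr π φ m n) 2

/-- The matrix `A = [a m n]`, as a matrix with entries in `ℓ²(G)`. -/
def corrMatrix (π : Multiplicative G →* (H ≃ₗᵢ[ℂ] H)) {N : ℕ} (φ : Fin N → H)
    (hA : CorrMemEll2 π φ) : Matrix (Fin N) (Fin N) (ell2 G) :=
  Matrix.of fun m n => ⟨corr π φ m n, hA m n⟩

variable [TopologicalSpace G] [DiscreteTopology G]

/-- The Gram matrix, the transpose of the entrywise Fourier transform of `A`; its entries are in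
`L²` of the dual group. -/
def gram (π : Multiplicative G →* (H ≃ₗᵢ[ℂ] H)) {N : ℕ} (φ : Fin N → H)
    (hA : CorrMemEll2 π φ) : Matrix (Fin N) (Fin N) (Lp ℂ 2 (haar G)) :=
  ((corrMatrix π φ hA).map fourierL2).transpose

/-- The value `𝒢(ξ)` of the Gram matrix. -/
def gramAt (π : Multiplicative G →* (H ≃ₗᵢ[ℂ] H)) {N : ℕ} (φ : Fin N → H)
    (hA : CorrMemEll2 π φ) (ξ : Dual G) : Matrix (Fin N) (Fin N) ℂ :=
  Matrix.of fun m n => gram π φ hA m n ξ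

/-- All the entries of the Gram matrix are in `L^∞` of the dual group. -/
def GramMemLinfty (π : Multiplicative G →* (H ≃ₗᵢ[ℂ] H)) {N : ℕ} (φ : Fin N → H)
    (hA : CorrMemEll2 π φ) : Prop :=
  ∀ m n, MemLp (gram π φ hA m n) ∞ (haar G)

end Systems

/-- The real eigenvalues of a complex matrix (all its eigenvalues if it is Hermitian). -/
def realEigenvalues {N : ℕ} (C : Matrix (Fin N) (Fin N) ℂ) : Set ℝ :=
  {t : ℝ | Module.End.HasEigenvalue (Matrix.toLin' C) (t : ℂ)}

/-- The largest eigenvalue of a positive semidefinite matrix (of size at least one). -/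
def lamMax {N : ℕ} (C : Matrix (Fin N) (Fin N) ℂ) : ℝ := sSup (realEigenvalues C)

/-- The smallest eigenvalue of a positive semidefinite matrix (of size at least one). -/
def lamMin {N : ℕ} (C : Matrix (Fin N) (Fin N) ℂ) : ℝ := sInf (realEigenvalues C)

end GroupRiesz

end

noncomputable section

namespace GroupRiesz

/-! ### Eigenvalue bounds for Hermitian matrices -/

section Matrix

open Matrix

variable {N : ℕ} {C : Matrix (Fin N) (Fin N) ℂ}

/-! The Gram matrix 𝒢 turns the norm of a finite sum into a quadratic form on the dual group. By
unitarity, inner products within the system depend only on differences g - h and are Fourier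
coefficients of entries of 𝒢. Hence, if v is the vector of trigonometric polynomials built from
conjugated coefficients `c`, the squared norm of the sum is ∫ v* 𝒢 v (`integral_trigVec_gramAt`),
while ∑ |c|² = ∫ v* v (`integral_trigVec_one`). So α and β bound all finite sums exactly when 𝒢 - α
and β - 𝒢 have nonnegative integrated forms on such v.

The analytic core, `ae_posSemidef_iff`, shows that this means positive semidefiniteness almost
everywhere. It rests on the scalar criterion `ae_nonneg_of_trigPoly`, where F is only in L² and |q|²
F is tested by density, from trigonometric polynomials to continuous functions to indicators.

Pointwise, the matrix conditions say α ≤ λ_min and λ_max ≤ β. For positive semidefinite matrices,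
bounded λ_max is equivalent to bounded entries, and then λ_min is bounded away from 0 exactly when
the determinant is. The passage between finite sums and ℓ² series is a Cauchy argument
(`isBesselBound_iff_finset`, `areRieszBounds_iff_finset`). -/

theorem realEigenvalues_eq_spectrum (C : Matrix (Fin N) (Fin N) ℂ) :
    realEigenvalues C = spectrum ℝ C := by
  ext t
  rw [← spectrum.algebraMap_mem_iff ℂ, ← Matrix.spectrum_toLin',
    ← Module.End.hasEigenvalue_iff_mem_spectrum]
  rfl

theorem realEigenvalues_finite (hC : C.IsHermitian) : (realEigenvalues C).Finite := by
  rw [realEigenvalues_eq_spectrum, hC.spectrum_real_eq_range_eigenvalues]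
  exact Set.finite_range _

theorem realEigenvalues_nonempty (hN : 0 < N) (hC : C.IsHermitian) :
    (realEigenvalues C).Nonempty := by
  rw [realEigenvalues_eq_spectrum, hC.spectrum_real_eq_range_eigenvalues]
  exact ⟨_, ⟨⟨0, hN⟩, rfl⟩⟩

theorem isHermitian_real_smul_one (β : ℝ) :
    ((β : ℂ) • (1 : Matrix (Fin N) (Fin N) ℂ)).IsHermitian := by
  ext i j
  simp [Matrix.conjTranspose_apply, Matrix.one_apply, eq_comm, apply_ite (starRingEnd ℂ)]

theorem posSemidef_iff_realEigenvalues (hC : C.IsHermitian) :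
    C.PosSemidef ↔ ∀ t ∈ realEigenvalues C, 0 ≤ t := by
  rw [hC.posSemidef_iff_eigenvalues_nonneg, realEigenvalues_eq_spectrum,
    hC.spectrum_real_eq_range_eigenvalues, Set.forall_mem_range]
  rfl

theorem real_smul_one_eq_algebraMap (β : ℝ) :
    ((β : ℂ) • (1 : Matrix (Fin N) (Fin N) ℂ)) = algebraMap ℝ _ β := by
  rw [Algebra.algebraMap_eq_smul_one]
  ext i j
  simp

theorem posSemidef_smul_one_sub_iff (hC : C.IsHermitian) (β : ℝ) :
    ((β : ℂ) • 1 - C).PosSemidef ↔ ∀ t ∈ realEigenvalues C, t ≤ β := by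
  rw [posSemidef_iff_realEigenvalues ((isHermitian_real_smul_one β).sub hC),
    realEigenvalues_eq_spectrum, realEigenvalues_eq_spectrum, real_smul_one_eq_algebraMap,
    ← spectrum.singleton_sub_eq]
  simp

theorem posSemidef_sub_smul_one_iff (hC : C.IsHermitian) (α : ℝ) :
    (C - (α : ℂ) • 1).PosSemidef ↔ ∀ t ∈ realEigenvalues C, α ≤ t := by
  rw [posSemidef_iff_realEigenvalues (hC.sub (isHermitian_real_smul_one α)),
    realEigenvalues_eq_spectrum, realEigenvalues_eq_spectrum, real_smul_one_eq_algebraMap,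
    ← spectrum.sub_singleton_eq]
  simp

/-- `0 < N` and finiteness of the spectrum keep the real `sSup` away from its default value 0. -/
theorem lamMax_le_iff (hN : 0 < N) (hC : C.IsHermitian) (β : ℝ) :
    lamMax C ≤ β ↔ ((β : ℂ) • 1 - C).PosSemidef := by
  rw [posSemidef_smul_one_sub_iff hC]
  exact csSup_le_iff (realEigenvalues_finite hC).bddAbove (realEigenvalues_nonempty hN hC)

theorem le_lamMin_iff (hN : 0 < N) (hC : C.IsHermitian) (α : ℝ) :
    α ≤ lamMin C ↔ (C - (α : ℂ) • 1).PosSemidef := by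
  rw [posSemidef_sub_smul_one_iff hC]
  exact le_csInf_iff (realEigenvalues_finite hC).bddBelow (realEigenvalues_nonempty hN hC)

theorem lamMin_le_lamMax (hN : 0 < N) (hC : C.IsHermitian) : lamMin C ≤ lamMax C := by
  obtain ⟨t, ht⟩ := realEigenvalues_nonempty hN hC
  exact (csInf_le (realEigenvalues_finite hC).bddBelow ht).trans
    (le_csSup (realEigenvalues_finite hC).bddAbove ht)

theorem eigenvalues_mem_realEigenvalues (hC : C.IsHermitian) (i : Fin N) :
    hC.eigenvalues i ∈ realEigenvalues C := by
  rw [realEigenvalues_eq_spectrum]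
  exact hC.eigenvalues_mem_spectrum_real i

theorem lamMin_le_eigenvalues (hC : C.IsHermitian) (i : Fin N) :
    lamMin C ≤ hC.eigenvalues i :=
  csInf_le (realEigenvalues_finite hC).bddBelow (eigenvalues_mem_realEigenvalues hC i)

theorem eigenvalues_le_lamMax (hC : C.IsHermitian) (i : Fin N) :
    hC.eigenvalues i ≤ lamMax C :=
  le_csSup (realEigenvalues_finite hC).bddAbove (eigenvalues_mem_realEigenvalues hC i)

theorem det_re_eq_prod_eigenvalues (hC : C.IsHermitian) :
    C.det.re = ∏ i, hC.eigenvalues i := by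
  rw [hC.det_eq_prod_eigenvalues]
  have : (∏ i, (hC.eigenvalues i : ℂ)) = ((∏ i, hC.eigenvalues i : ℝ) : ℂ) := by push_cast; rfl
  exact (congrArg Complex.re this).trans (Complex.ofReal_re _)

theorem pow_le_det_re (hC : C.IsHermitian) {α : ℝ} (hα : 0 ≤ α) (h : α ≤ lamMin C) :
    α ^ N ≤ C.det.re := by
  rw [det_re_eq_prod_eigenvalues hC]
  calc α ^ N = ∏ _i : Fin N, α := by simp
    _ ≤ _ := Finset.prod_le_prod (fun _ _ => hα) fun i _ => h.trans (lamMin_le_eigenvalues hC i)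

theorem det_re_le_pow (hC : C.PosSemidef) {β : ℝ} (h : lamMax C ≤ β) : C.det.re ≤ β ^ N := by
  rw [det_re_eq_prod_eigenvalues hC.1]
  calc _ ≤ ∏ _i : Fin N, β := Finset.prod_le_prod (fun i _ => hC.eigenvalues_nonneg i)
        fun i _ => (eigenvalues_le_lamMax hC.1 i).trans h
    _ = β ^ N := by simp

/-- The determinant is any one eigenvalue times the N - 1 others, each of which lies in [0, β]. -/
theorem div_le_lamMin (hN : 0 < N) (hC : C.PosSemidef) {β δ : ℝ} (hβ : 0 < β)
    (h : lamMax C ≤ β) (hδ : δ ≤ C.det.re) : δ / β ^ (N - 1) ≤ lamMin C := by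
  refine le_csInf (realEigenvalues_nonempty hN hC.1) fun t ht => ?_
  rw [realEigenvalues_eq_spectrum, hC.1.spectrum_real_eq_range_eigenvalues] at ht
  obtain ⟨i, rfl⟩ := ht
  rw [div_le_iff₀ (pow_pos hβ _)]
  refine hδ.trans ?_
  rw [det_re_eq_prod_eigenvalues hC.1, ← Finset.mul_prod_erase _ _ (Finset.mem_univ i)]
  refine mul_le_mul_of_nonneg_left ?_ (hC.eigenvalues_nonneg i)
  calc _ ≤ ∏ _j ∈ Finset.univ.erase i, β := Finset.prod_le_prod
        (fun j _ => hC.eigenvalues_nonneg j) fun j _ => (eigenvalues_le_lamMax hC.1 j).trans h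
    _ = β ^ (N - 1) := by simp [Finset.card_erase_of_mem]

theorem lamMax_nonneg (hN : 0 < N) (hC : C.PosSemidef) : 0 ≤ lamMax C :=
  (hC.eigenvalues_nonneg ⟨0, hN⟩).trans (eigenvalues_le_lamMax hC.1 _)

/-- A complex matrix whose quadratic form is nonnegative is Hermitian. -/
theorem posSemidef_of_forall_nonneg (h : ∀ v : Fin N → ℂ, 0 ≤ star v ⬝ᵥ C *ᵥ v) :
    C.PosSemidef := by
  rw [← Matrix.isPositive_toEuclideanLin_iff, LinearMap.isPositive_iff_complex]
  intro x
  have h1 : inner ℂ (Matrix.toEuclideanLin C x) x = star (star x.ofLp ⬝ᵥ C *ᵥ x.ofLp) := by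
    rw [← inner_conj_symm, EuclideanSpace.inner_eq_star_dotProduct, dotProduct_comm]
    rfl
  obtain ⟨h2, h3⟩ := Complex.nonneg_iff.1 (h x.ofLp)
  rw [h1]
  refine ⟨?_, by simpa using h2⟩
  apply Complex.ext
  · simp
  · simpa using h3.symm

/-- Diagonal entries lie in [0, β]; off the diagonal, the principal 2 × 2 minor gives |C_mn|² ≤ C_mm
C_nn. -/
theorem norm_entry_le_of_posSemidef_sub {β : ℝ} (hC : C.PosSemidef)
    (hβ : ((β : ℂ) • 1 - C).PosSemidef) (m n : Fin N) : ‖C m n‖ ≤ β := by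
  have hd : ∀ i, (C i i).re ≤ β := fun i => by
    have := (Complex.nonneg_iff.1 (hβ.diag_nonneg (i := i))).1
    simpa using this
  have hd0 : ∀ i, 0 ≤ (C i i).re := fun i => (Complex.nonneg_iff.1 (hC.diag_nonneg (i := i))).1
  have hβ0 := (hd0 m).trans (hd m)
  by_cases hmn : m = n
  · subst hmn
    have h := (Complex.nonneg_iff.1 (hC.diag_nonneg (i := m)))
    have : C m m = ((C m m).re : ℂ) := Complex.ext (by simp) (by simpa using h.2.symm)
    rw [this, Complex.norm_real, Real.norm_of_nonneg (hd0 m)]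
    exact hd m
  have h2 := (hC.submatrix ![m, n]).det_nonneg
  rw [Matrix.det_fin_two] at h2
  have h3 := (Complex.nonneg_iff.1 h2).1
  have e : C n m = star (C m n) := (hC.1.apply n m).symm
  have hi : ∀ i, (C i i).im = 0 := fun i =>
    (Complex.nonneg_iff.1 (hC.diag_nonneg (i := i))).2.symm
  simp [e, hi, Complex.mul_re] at h3
  have h4 : ‖C m n‖ ^ 2 ≤ β ^ 2 := by
    rw [← Complex.normSq_eq_norm_sq, Complex.normSq_apply]
    nlinarith [mul_le_mul (hd m) (hd n) (hd0 n) hβ0]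
  exact (sq_le_sq₀ (norm_nonneg _) hβ0).1 h4

/-- Nonnegative eigenvalues are each at most their sum, the trace. -/
theorem lamMax_le_of_norm_entry_le (hN : 0 < N) (hC : C.PosSemidef) {c : ℝ}
    (hc : ∀ i, ‖C i i‖ ≤ c) : lamMax C ≤ N * c := by
  refine csSup_le (realEigenvalues_nonempty hN hC.1) fun t ht => ?_
  rw [realEigenvalues_eq_spectrum, hC.1.spectrum_real_eq_range_eigenvalues] at ht
  obtain ⟨i, rfl⟩ := ht
  have h : C.trace.re = ∑ j, hC.1.eigenvalues j := by
    rw [hC.1.trace_eq_sum_eigenvalues]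
    simp
  calc hC.1.eigenvalues i ≤ ∑ j, hC.1.eigenvalues j :=
        Finset.single_le_sum (fun j _ => hC.eigenvalues_nonneg j) (Finset.mem_univ i)
    _ = ∑ j, (C j j).re := by rw [← h, Matrix.trace, Complex.re_sum]; rfl
    _ ≤ ∑ _j : Fin N, c := Finset.sum_le_sum fun j _ => (Complex.re_le_norm _).trans (hc j)
    _ = N * c := by simp

end Matrix

/-! ### Trigonometric polynomials on the dual group -/

section TrigPoly

variable {G : Type*} [AddCommGroup G] [TopologicalSpace G]

theorem pairing_add (g h : G) (ξ : Dual G) : pairing (g + h) ξ = pairing g ξ * pairing h ξ := by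
  change ((ξ (Multiplicative.ofAdd (g + h)) : Circle) : ℂ) = _
  rw [ofAdd_add, map_mul, Circle.coe_mul]
  rfl

theorem pairing_neg (g : G) (ξ : Dual G) : pairing (-g) ξ = star (pairing g ξ) := by
  change ((ξ (Multiplicative.ofAdd (-g)) : Circle) : ℂ) = _
  rw [ofAdd_neg, map_inv, Circle.coe_inv_eq_conj]
  rfl

theorem pairing_zero (ξ : Dual G) : pairing (0 : G) ξ = 1 := by
  unfold pairing
  rw [ofAdd_zero, map_one, Circle.coe_one]

theorem pairing_sub (g h : G) (ξ : Dual G) :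
    pairing (g - h) ξ = pairing g ξ * star (pairing h ξ) := by
  rw [sub_eq_add_neg, pairing_add, pairing_neg]

theorem charFun_apply (g : G) (ξ : Dual G) : charFun g ξ = pairing (-g) ξ := rfl

open Matrix

variable {N : ℕ}

/-- The vector of trigonometric polynomials with coefficients `star (c (n, g))`, `(n, g) ∈ s`. -/
def trigVec (s : Finset (Fin N × G)) (c : Fin N × G → ℂ) (ξ : Dual G) : Fin N → ℂ :=
  ∑ p ∈ s, Pi.single p.1 (star (c p) * pairing p.2 ξ)

theorem star_trigVec_dotProduct_mulVec (s : Finset (Fin N × G)) (c : Fin N × G → ℂ)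
    (C : Matrix (Fin N) (Fin N) ℂ) (ξ : Dual G) :
    star (trigVec s c ξ) ⬝ᵥ C *ᵥ trigVec s c ξ =
      ∑ p ∈ s, ∑ q ∈ s, star (c p) * c q * (pairing (p.2 - q.2) ξ * C q.1 p.1) := by
  simp only [trigVec, star_sum, sum_dotProduct, mulVec_sum, dotProduct_sum]
  refine Finset.sum_congr rfl fun p _ => Finset.sum_congr rfl fun q _ => ?_
  rw [← Pi.single_star, single_dotProduct, mulVec_single, pairing_sub]
  simp only [star_mul, star_star, Pi.smul_apply, op_smul_eq_mul, Matrix.col_apply]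
  ring

/-- A trigonometric polynomial times a constant vector is of the form `trigVec`. -/
theorem exists_trigVec_eq_smul {q : C(Dual G, ℂ)}
    (hq : q ∈ Submodule.span ℂ (Set.range (charFun (G := G)))) (v : Fin N → ℂ) :
    ∃ (s : Finset (Fin N × G)) (c : Fin N × G → ℂ), ∀ ξ, trigVec s c ξ = q ξ • v := by
  obtain ⟨d, rfl⟩ := (Finsupp.mem_span_range_iff_exists_finsupp).1 hq
  -- The support is negated because `charFun g` is the pairing with -g, and the coefficients are
  -- conjugated because `trigVec` conjugates them back.
  refine ⟨Finset.univ ×ˢ d.support.map (Equiv.neg G).toEmbedding,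
    fun p => star (v p.1 * d (-p.2)), fun ξ => ?_⟩
  have e : (d.sum fun g a => a • charFun g) ξ = ∑ g ∈ d.support, d g * pairing (-g) ξ := by
    simp [Finsupp.sum, charFun_apply]
  rw [e]
  ext n
  simp only [trigVec, Finset.sum_product, Finset.sum_apply, Finset.sum_map, star_star,
    Equiv.coe_toEmbedding, Equiv.neg_apply, neg_neg, Pi.smul_apply, smul_eq_mul]
  rw [Finset.sum_eq_single n (fun m _ hm => Finset.sum_eq_zero fun g _ =>
    Pi.single_eq_of_ne hm.symm _) (by simp), Finset.sum_mul]
  refine Finset.sum_congr rfl fun g _ => ?_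
  rw [Pi.single_eq_same]
  ring

variable [DiscreteTopology G]

/-- The star subalgebra of trigonometric polynomials on the dual group. -/
def trigSubalgebra (G : Type*) [AddCommGroup G] [TopologicalSpace G] [DiscreteTopology G] :
    StarSubalgebra ℂ C(Dual G, ℂ) where
  toSubalgebra := Algebra.adjoin ℂ (Set.range (charFun (G := G)))
  star_mem' := by
    change Algebra.adjoin ℂ (Set.range (charFun (G := G))) ≤
      star (Algebra.adjoin ℂ (Set.range (charFun (G := G))))
    refine Algebra.adjoin_le ?_
    rintro - ⟨g, rfl⟩
    refine Algebra.subset_adjoin ⟨-g, ContinuousMap.ext fun ξ => ?_⟩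
    rw [charFun_apply, pairing_neg]
    rfl

/-- Characters are closed under products, so the algebra they generate is already their linear span.
-/
theorem toSubmodule_trigSubalgebra :
    Subalgebra.toSubmodule (trigSubalgebra G).toSubalgebra =
      Submodule.span ℂ (Set.range (charFun (G := G))) := by
  apply Algebra.adjoin_eq_span_of_subset
  refine Set.Subset.trans ?_ Submodule.subset_span
  intro x hx
  refine Submonoid.closure_induction (fun _ => id) ⟨0, ?_⟩ ?_ hx
  · ext1 ξ
    rw [charFun_apply, neg_zero, pairing_zero]
    rfl
  · rintro - - - - ⟨g, rfl⟩ ⟨h, rfl⟩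
    refine ⟨g + h, ?_⟩
    ext1 ξ
    rw [charFun_apply, neg_add, pairing_add]
    rfl

theorem trigSubalgebra_separatesPoints : (trigSubalgebra G).SeparatesPoints := by
  intro ξ η hne
  by_contra! hcon
  refine hne ?_
  refine DFunLike.ext _ _ fun a => ?_
  have h := hcon _ ⟨charFun (-(Multiplicative.toAdd a)), Algebra.subset_adjoin ⟨_, rfl⟩, rfl⟩
  simp only [charFun_apply, neg_neg] at h
  exact Subtype.ext h

/-- Stone–Weierstrass in the sup norm. -/
theorem closure_span_charFun :
    closure (Submodule.span ℂ (Set.range (charFun (G := G))) : Set C(Dual G, ℂ)) = Set.univ := by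
  have h := ContinuousMap.starSubalgebra_topologicalClosure_eq_top_of_separatesPoints
    (trigSubalgebra G) trigSubalgebra_separatesPoints
  rw [← toSubmodule_trigSubalgebra]
  have h2 := congrArg (fun A : StarSubalgebra ℂ C(Dual G, ℂ) => (A : Set C(Dual G, ℂ))) h
  simpa using h2

/-! ### Positivity tested on trigonometric polynomials -/

theorem inner_toLp_left (c : C(Dual G, ℂ)) (F : Lp ℂ 2 (haar G)) :
    inner ℂ (ContinuousMap.toLp 2 (haar G) ℂ c) F = ∫ ξ, star (c ξ) * F ξ ∂(haar G) := by
  rw [L2.inner_def]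
  refine integral_congr_ae ?_
  filter_upwards [ContinuousMap.coeFn_toLp (p := 2) (𝕜 := ℂ) (haar G) c] with ξ hξ
  rw [RCLike.inner_apply, hξ, mul_comm]
  rfl

/-- If `∫ |q|² F ≥ 0` for all trigonometric polynomials `q`, then this holds for all continuous
functions. -/
theorem inner_star_mul_self_nonneg {F : Lp ℂ 2 (haar G)}
    (h : ∀ q ∈ Submodule.span ℂ (Set.range (charFun (G := G))),
      0 ≤ ∫ ξ, star (q ξ) * q ξ * F ξ ∂(haar G)) (c : C(Dual G, ℂ)) :
    0 ≤ inner ℂ (ContinuousMap.toLp 2 (haar G) ℂ (star c * c)) F := by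
  have hcl : IsClosed {c : C(Dual G, ℂ) |
      0 ≤ inner ℂ (ContinuousMap.toLp 2 (haar G) ℂ (star c * c)) F} := by
    refine isClosed_le continuous_const ?_
    refine Continuous.inner ?_ continuous_const
    exact (ContinuousMap.toLp 2 (haar G) ℂ).continuous.comp (continuous_star.mul continuous_id)
  have hsub : (Submodule.span ℂ (Set.range (charFun (G := G))) : Set C(Dual G, ℂ)) ⊆
      {c | 0 ≤ inner ℂ (ContinuousMap.toLp 2 (haar G) ℂ (star c * c)) F} := by
    intro q hq
    change 0 ≤ inner ℂ _ F
    rw [inner_toLp_left]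
    convert h q hq using 4
    simp [mul_comm]
  exact closure_minimal hsub hcl (closure_span_charFun (G := G) ▸ Set.mem_univ c)

/-- |c| is the square of the continuous function √|c|. Unlike |c|², the expression |c| is Lipschitz
in c, so it extends continuously to L². -/
theorem inner_toLp_norm_nonneg {F : Lp ℂ 2 (haar G)}
    (h : ∀ q ∈ Submodule.span ℂ (Set.range (charFun (G := G))),
      0 ≤ ∫ ξ, star (q ξ) * q ξ * F ξ ∂(haar G)) (c : C(Dual G, ℂ)) :
    0 ≤ ∫ ξ, (‖c ξ‖ : ℂ) * F ξ ∂(haar G) := by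
  let d : C(Dual G, ℂ) := ⟨fun ξ => (Real.sqrt ‖c ξ‖ : ℂ), by fun_prop⟩
  have hd := inner_star_mul_self_nonneg h d
  rw [inner_toLp_left] at hd
  convert hd using 4 with ξ
  have : (star d * d) ξ = (‖c ξ‖ : ℂ) := by
    change star (Real.sqrt ‖c ξ‖ : ℂ) * (Real.sqrt ‖c ξ‖ : ℂ) = _
    rw [Complex.star_def, Complex.conj_ofReal, ← Complex.ofReal_mul,
      Real.mul_self_sqrt (norm_nonneg _)]
  rw [this, Complex.star_def, Complex.conj_ofReal]

theorem lipschitzWith_ofReal_norm : LipschitzWith 1 (fun z : ℂ => ((‖z‖ : ℝ) : ℂ)) := by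
  refine LipschitzWith.of_dist_le_mul fun z w => ?_
  rw [Complex.dist_eq, ← Complex.ofReal_sub, Complex.norm_real, NNReal.coe_one, one_mul,
    Complex.dist_eq]
  exact abs_norm_sub_norm_le z w

/-- The functional u ↦ ∫ |u| F is continuous on L² and nonnegative on the dense set of continuous
functions, hence everywhere; it is evaluated at the indicator of `s`, which equals its own modulus.
-/
theorem setIntegral_nonneg_of_trigPoly {F : Lp ℂ 2 (haar G)}
    (h : ∀ q ∈ Submodule.span ℂ (Set.range (charFun (G := G))),
      0 ≤ ∫ ξ, star (q ξ) * q ξ * F ξ ∂(haar G)) {s : Set (Dual G)} (hs : MeasurableSet s) :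
    0 ≤ ∫ ξ in s, F ξ ∂(haar G) := by
  have h0 : (fun z : ℂ => ((‖z‖ : ℝ) : ℂ)) 0 = 0 := by simp
  let A : Lp ℂ 2 (haar G) → Lp ℂ 2 (haar G) := lipschitzWith_ofReal_norm.compLp h0
  have hA : Continuous A := lipschitzWith_ofReal_norm.continuous_compLp h0
  have hAu (u : Lp ℂ 2 (haar G)) : A u =ᵐ[haar G] fun ξ => ((‖u ξ‖ : ℝ) : ℂ) :=
    lipschitzWith_ofReal_norm.coeFn_compLp h0 u
  have hcl : IsClosed {u : Lp ℂ 2 (haar G) | 0 ≤ inner ℂ (A u) F} :=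
    isClosed_le continuous_const (Continuous.inner hA continuous_const)
  have hsub : Set.range (ContinuousMap.toLp (E := ℂ) 2 (haar G) ℂ) ⊆
      {u | 0 ≤ inner ℂ (A u) F} := by
    rintro - ⟨c, rfl⟩
    change 0 ≤ inner ℂ _ F
    rw [L2.inner_def]
    convert inner_toLp_norm_nonneg h c using 1
    refine integral_congr_ae ?_
    filter_upwards [ContinuousMap.coeFn_toLp (p := 2) (𝕜 := ℂ) (haar G) c,
      hAu (ContinuousMap.toLp 2 (haar G) ℂ c)] with ξ h1 h2
    rw [RCLike.inner_apply, h2, h1, mul_comm, Complex.conj_ofReal]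
  have hall := closure_minimal hsub hcl
    ((ContinuousMap.toLp_denseRange ℂ (haar G) (p := 2) ℂ ENNReal.ofNat_ne_top)
      (indicatorConstLp 2 hs (measure_ne_top _ _) (1 : ℂ)))
  have hA1 : A (indicatorConstLp 2 hs (measure_ne_top _ _) (1 : ℂ)) =
      indicatorConstLp 2 hs (measure_ne_top _ _) (1 : ℂ) := by
    apply Lp.ext
    filter_upwards [hAu (indicatorConstLp 2 hs (measure_ne_top _ _) (1 : ℂ)),
      indicatorConstLp_coeFn (p := 2) (hs := hs) (hμs := measure_ne_top (haar G) s)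
        (c := (1 : ℂ))] with ξ h1 h2
    rw [h1, h2]
    by_cases hξ : ξ ∈ s <;> simp [hξ]
  change 0 ≤ inner ℂ (A _) F at hall
  rwa [hA1, L2.inner_indicatorConstLp_one] at hall

theorem ae_nonneg_of_trigPoly {F : Lp ℂ 2 (haar G)}
    (h : ∀ q ∈ Submodule.span ℂ (Set.range (charFun (G := G))),
      0 ≤ ∫ ξ, star (q ξ) * q ξ * F ξ ∂(haar G)) : ∀ᵐ ξ ∂(haar G), 0 ≤ F ξ := by
  have hF : Integrable F (haar G) := (Lp.memLp F).integrable one_le_two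
  have hset : ∀ s, MeasurableSet s → 0 ≤ ∫ ξ in s, F ξ ∂(haar G) :=
    fun s hs => setIntegral_nonneg_of_trigPoly h hs
  have hre : ∀ s, ∫ ξ in s, (F ξ).re ∂(haar G) = (∫ ξ in s, F ξ ∂(haar G)).re :=
    fun s => integral_re hF.integrableOn
  have him : ∀ s, ∫ ξ in s, (F ξ).im ∂(haar G) = (∫ ξ in s, F ξ ∂(haar G)).im :=
    fun s => integral_im hF.integrableOn
  have h1 : 0 ≤ᵐ[haar G] fun ξ => (F ξ).re :=
    ae_nonneg_of_forall_setIntegral_nonneg hF.re fun s hs _ => by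
      rw [hre]; exact (Complex.nonneg_iff.1 (hset s hs)).1
  have h2 : 0 ≤ᵐ[haar G] fun ξ => (F ξ).im :=
    ae_nonneg_of_forall_setIntegral_nonneg hF.im fun s hs _ => by
      rw [him]; exact (Complex.nonneg_iff.1 (hset s hs)).2.le
  have h3 : 0 ≤ᵐ[haar G] fun ξ => -(F ξ).im :=
    ae_nonneg_of_forall_setIntegral_nonneg hF.im.neg fun s hs _ => by
      rw [integral_neg, him, ← (Complex.nonneg_iff.1 (hset s hs)).2, neg_zero]
  filter_upwards [h1, h2, h3] with ξ a1 a2 a3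
  exact Complex.nonneg_iff.2 ⟨a1, le_antisymm a2 (neg_nonneg.1 a3)⟩

theorem integrable_pairing_mul (g : G) {f : Dual G → ℂ} (hf : Integrable f (haar G)) :
    Integrable (fun ξ => pairing g ξ * f ξ) (haar G) := by
  refine hf.bdd_mul (c := 1) ?_ ?_
  · have h := (charFun (-g)).continuous
    simp only [charFun, neg_neg] at h
    exact h.aestronglyMeasurable
  · exact Filter.Eventually.of_forall fun ξ => (Circle.norm_coe _).le

theorem integrable_trigVec_form (s : Finset (Fin N × G)) (c : Fin N × G → ℂ)
    {K : Dual G → Matrix (Fin N) (Fin N) ℂ}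
    (hK : ∀ m n, Integrable (fun ξ => K ξ m n) (haar G)) :
    Integrable (fun ξ => star (trigVec s c ξ) ⬝ᵥ K ξ *ᵥ trigVec s c ξ) (haar G) := by
  simp only [star_trigVec_dotProduct_mulVec]
  exact integrable_finsetSum _ fun p _ => integrable_finsetSum _ fun q _ =>
    (integrable_pairing_mul _ (hK _ _)).const_mul _

theorem integral_trigVec_form (s : Finset (Fin N × G)) (c : Fin N × G → ℂ)
    {K : Dual G → Matrix (Fin N) (Fin N) ℂ}
    (hK : ∀ m n, Integrable (fun ξ => K ξ m n) (haar G)) :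
    ∫ ξ, star (trigVec s c ξ) ⬝ᵥ K ξ *ᵥ trigVec s c ξ ∂(haar G) =
      ∑ p ∈ s, ∑ q ∈ s, star (c p) * c q *
        ∫ ξ, pairing (p.2 - q.2) ξ * K ξ q.1 p.1 ∂(haar G) := by
  simp only [star_trigVec_dotProduct_mulVec]
  have hint : ∀ p q : Fin N × G, Integrable (fun ξ =>
      star (c p) * c q * (pairing (p.2 - q.2) ξ * K ξ q.1 p.1)) (haar G) :=
    fun p q => (integrable_pairing_mul _ (hK _ _)).const_mul _
  rw [integral_finsetSum _ fun p _ => integrable_finsetSum _ fun q _ => hint p q]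
  refine Finset.sum_congr rfl fun p _ => ?_
  rw [integral_finsetSum _ fun q _ => hint p q]
  exact Finset.sum_congr rfl fun q _ => integral_const_mul _ _

/-- Testing on q • v, with q a trigonometric polynomial and v a fixed vector, reduces matrix
positivity to the scalar criterion for v* K v. -/
theorem ae_posSemidef_iff {K : Dual G → Matrix (Fin N) (Fin N) ℂ}
    (hK : ∀ m n, MemLp (fun ξ => K ξ m n) 2 (haar G)) :
    (∀ᵐ ξ ∂(haar G), (K ξ).PosSemidef) ↔
      ∀ (s : Finset (Fin N × G)) (c : Fin N × G → ℂ),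
        0 ≤ ∫ ξ, star (trigVec s c ξ) ⬝ᵥ K ξ *ᵥ trigVec s c ξ ∂(haar G) := by
  constructor
  · intro h s c
    refine integral_nonneg_of_ae ?_
    filter_upwards [h] with ξ hξ
    exact hξ.dotProduct_mulVec_nonneg _
  intro h
  have hv : ∀ v : Fin N → ℂ, ∀ᵐ ξ ∂(haar G), 0 ≤ star v ⬝ᵥ K ξ *ᵥ v := by
    intro v
    have hmem : MemLp (fun ξ => star v ⬝ᵥ K ξ *ᵥ v) 2 (haar G) := by
      simp only [dotProduct, mulVec]
      exact memLp_finsetSum _ fun m _ => (memLp_finsetSum _ fun n _ =>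
        (hK m n).mul_const (v n)).const_mul (star v m)
    have h1 := ae_nonneg_of_trigPoly (F := hmem.toLp _) fun q hq => by
      obtain ⟨s, c, hs⟩ := exists_trigVec_eq_smul hq v
      convert h s c using 1
      refine integral_congr_ae ?_
      filter_upwards [hmem.coeFn_toLp] with ξ hξ
      rw [hξ, hs, mulVec_smul, star_smul, smul_dotProduct, dotProduct_smul]
      simp only [smul_eq_mul]
      ring
    filter_upwards [h1, hmem.coeFn_toLp] with ξ a1 a2
    rwa [a2] at a1
  -- The exceptional null set depends on v; a countable dense set of vectors gives a common one, and
  -- continuity in v does the rest.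
  have hall := ae_all_iff.2 fun k => hv (TopologicalSpace.denseSeq (Fin N → ℂ) k)
  filter_upwards [hall] with ξ hξ
  refine posSemidef_of_forall_nonneg fun v => ?_
  have hcl : IsClosed {v : Fin N → ℂ | 0 ≤ star v ⬝ᵥ K ξ *ᵥ v} := by
    refine isClosed_le continuous_const ?_
    exact continuous_star.dotProduct (continuous_const.matrix_mulVec continuous_id)
  exact closure_minimal (Set.range_subset_iff.2 hξ) hcl
    (TopologicalSpace.denseRange_denseSeq (Fin N → ℂ) v)

theorem inner_charLp_fourierL2 (g : G) (a : ell2 G) :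
    inner ℂ (charLp g) (fourierL2 a) = a g := by
  classical
  have h : fourierL2 (lp.single 2 g (1 : ℂ)) = charLp g := by
    unfold fourierL2
    rw [OrthogonalFamily.linearIsometry_apply_single]
    simp
  rw [← h, LinearIsometry.inner_map_map, lp.inner_single_left]
  simp

/-- Fourier inversion of coefficients: the transform uses ⟨-g, ·⟩, so a(g) is recovered by pairing
with ⟨g, ·⟩. -/
theorem integral_pairing_mul_fourierL2 (g : G) (a : ell2 G) :
    ∫ ξ, pairing g ξ * fourierL2 a ξ ∂(haar G) = a g := by
  rw [← inner_charLp_fourierL2 g a]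
  unfold charLp
  rw [inner_toLp_left]
  simp only [charFun_apply, pairing_neg, star_star]

end TrigPoly

/-! ### Finite sums as integrals of the Gram form -/

section Finite

open Matrix

variable {G : Type*} [AddCommGroup G] {H : Type*} [NormedAddCommGroup H] [InnerProductSpace ℂ H]
  (π : Multiplicative G →* (H ≃ₗᵢ[ℂ] H)) {N : ℕ} (φ : Fin N → H)

theorem inner_orbit (m n : Fin N) (g h : G) :
    inner ℂ (π (Multiplicative.ofAdd g) (φ m)) (π (Multiplicative.ofAdd h) (φ n)) =
      corr π φ m n (g - h) := by
  have e : g = h + (g - h) := by abel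
  conv_lhs => rw [e, ofAdd_add, map_mul]
  exact (π (Multiplicative.ofAdd h)).inner_map_map (π (Multiplicative.ofAdd (g - h)) (φ m)) (φ n)

variable [TopologicalSpace G] [DiscreteTopology G] (hA : CorrMemEll2 π φ)

theorem memLp_gramAt (m n : Fin N) : MemLp (fun ξ => gramAt π φ hA ξ m n) 2 (haar G) :=
  Lp.memLp (gram π φ hA m n)

theorem integral_pairing_mul_gramAt (m n : Fin N) (g : G) :
    ∫ ξ, pairing g ξ * gramAt π φ hA ξ m n ∂(haar G) = corr π φ n m g :=
  integral_pairing_mul_fourierL2 g _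

/-- Both sides expand into the same double sum; the transpose in the Gram matrix matches the
conjugated coefficients of `trigVec`. -/
theorem integral_trigVec_gramAt (s : Finset (Fin N × G)) (c : Fin N × G → ℂ) :
    ∫ ξ, star (trigVec s c ξ) ⬝ᵥ gramAt π φ hA ξ *ᵥ trigVec s c ξ ∂(haar G) =
      ((‖∑ p ∈ s, c p • π (Multiplicative.ofAdd p.2) (φ p.1)‖ ^ 2 : ℝ) : ℂ) := by
  rw [integral_trigVec_form s c fun m n => (memLp_gramAt π φ hA m n).integrable one_le_two,
    Complex.ofReal_pow]
  refine Eq.trans ?_ (inner_self_eq_norm_sq_to_K (𝕜 := ℂ)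
    (∑ p ∈ s, c p • π (Multiplicative.ofAdd p.2) (φ p.1)))
  rw [sum_inner]
  refine Finset.sum_congr rfl fun p _ => ?_
  rw [inner_sum]
  refine Finset.sum_congr rfl fun q _ => ?_
  rw [integral_pairing_mul_gramAt, inner_smul_left, inner_smul_right, inner_orbit, mul_assoc]
  rfl

theorem integral_trigVec_one (s : Finset (Fin N × G)) (c : Fin N × G → ℂ) :
    ∫ ξ, star (trigVec s c ξ) ⬝ᵥ (1 : Matrix (Fin N) (Fin N) ℂ) *ᵥ trigVec s c ξ ∂(haar G) =
      ((∑ p ∈ s, ‖c p‖ ^ 2 : ℝ) : ℂ) := by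
  classical
  rw [integral_trigVec_form s c (K := fun _ => 1) fun m n => integrable_const _, Complex.ofReal_sum]
  refine Finset.sum_congr rfl fun p hp => ?_
  have h1 : ∀ q : Fin N × G, ∫ ξ, pairing (p.2 - q.2) ξ *
      (1 : Matrix (Fin N) (Fin N) ℂ) q.1 p.1 ∂(haar G) = if p = q then 1 else 0 := by
    intro q
    rw [integral_mul_const]
    by_cases h2 : p.2 = q.2
    · have : ∫ ξ : Dual G, pairing (p.2 - q.2) ξ ∂(haar G) = 1 := by
        simp [h2, pairing_zero]
      rw [this, one_mul, Matrix.one_apply]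
      exact if_congr (by rw [Prod.ext_iff]; exact ⟨fun h => ⟨h.symm, h2⟩, fun h => h.1.symm⟩) rfl rfl
    · rw [integral_pairing (sub_ne_zero.2 h2), zero_mul, if_neg fun h => h2 (congrArg _ h)]
  simp only [h1, mul_ite, mul_one, mul_zero, Finset.sum_ite_eq, hp, if_true]
  rw [Complex.star_def, ← Complex.normSq_eq_conj_mul_self, Complex.normSq_eq_norm_sq]

/-- Used with (a, b) = (1, 0) for positivity, (-1, β) for the upper bound and (1, -α) for the lower
bound. -/
theorem ae_posSemidef_smul_gramAt_add_iff (a b : ℝ) :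
    (∀ᵐ ξ ∂(haar G), ((a : ℂ) • gramAt π φ hA ξ + (b : ℂ) • 1).PosSemidef) ↔
      ∀ (s : Finset (Fin N × G)) (c : Fin N × G → ℂ),
        0 ≤ a * ‖∑ p ∈ s, c p • π (Multiplicative.ofAdd p.2) (φ p.1)‖ ^ 2 +
          b * ∑ p ∈ s, ‖c p‖ ^ 2 := by
  rw [ae_posSemidef_iff]
  · refine forall₂_congr fun s c => ?_
    have e : ∀ ξ, star (trigVec s c ξ) ⬝ᵥ ((a : ℂ) • gramAt π φ hA ξ + (b : ℂ) • 1) *ᵥ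
        trigVec s c ξ = (a : ℂ) * (star (trigVec s c ξ) ⬝ᵥ gramAt π φ hA ξ *ᵥ trigVec s c ξ) +
          (b : ℂ) * (star (trigVec s c ξ) ⬝ᵥ (1 : Matrix (Fin N) (Fin N) ℂ) *ᵥ
            trigVec s c ξ) := by
      intro ξ
      rw [add_mulVec, smul_mulVec, smul_mulVec, dotProduct_add, dotProduct_smul,
        dotProduct_smul, smul_eq_mul, smul_eq_mul]
    simp only [e]
    rw [integral_add, integral_const_mul, integral_const_mul, integral_trigVec_gramAt,
      integral_trigVec_one]
    · rw [← Complex.ofReal_mul, ← Complex.ofReal_mul, ← Complex.ofReal_add, Complex.zero_le_real]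
    · exact (integrable_trigVec_form s c fun m n =>
        (memLp_gramAt π φ hA m n).integrable one_le_two).const_mul _
    · exact (integrable_trigVec_form s c (K := fun _ => 1) fun m n =>
        integrable_const _).const_mul _
  · intro m n
    have h1 : MemLp (fun ξ => (a : ℂ) * gramAt π φ hA ξ m n) 2 (haar G) :=
      (memLp_gramAt π φ hA m n).const_mul (a : ℂ)
    have h2 : MemLp (fun _ : Dual G => (b : ℂ) * (1 : Matrix (Fin N) (Fin N) ℂ) m n) 2 (haar G) :=
      memLp_const _
    exact h1.add h2

theorem ae_posSemidef_gramAt : ∀ᵐ ξ ∂(haar G), (gramAt π φ hA ξ).PosSemidef := by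
  have h := (ae_posSemidef_smul_gramAt_add_iff π φ hA 1 0).2 fun s c => by
    rw [one_mul, zero_mul, add_zero]
    positivity
  simpa using h

theorem ae_lamMax_le_iff (hN : 0 < N) (β : ℝ) :
    (∀ᵐ ξ ∂(haar G), lamMax (gramAt π φ hA ξ) ≤ β) ↔
      ∀ (s : Finset (Fin N × G)) (c : Fin N × G → ℂ),
        ‖∑ p ∈ s, c p • π (Multiplicative.ofAdd p.2) (φ p.1)‖ ^ 2 ≤ β * ∑ p ∈ s, ‖c p‖ ^ 2 := by
  have h := ae_posSemidef_smul_gramAt_add_iff π φ hA (-1) β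
  have h1 : (∀ᵐ ξ ∂(haar G), lamMax (gramAt π φ hA ξ) ≤ β) ↔
      ∀ᵐ ξ ∂(haar G), (((-1 : ℝ) : ℂ) • gramAt π φ hA ξ + (β : ℂ) • 1).PosSemidef := by
    refine Filter.eventually_congr ?_
    filter_upwards [ae_posSemidef_gramAt π φ hA] with ξ hξ
    rw [lamMax_le_iff hN hξ.1, sub_eq_neg_add]
    simp
  rw [h1, h]
  refine forall₂_congr fun s c => ?_
  rw [neg_one_mul, neg_add_eq_sub, sub_nonneg]

theorem ae_le_lamMin_iff (hN : 0 < N) (α : ℝ) :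
    (∀ᵐ ξ ∂(haar G), α ≤ lamMin (gramAt π φ hA ξ)) ↔
      ∀ (s : Finset (Fin N × G)) (c : Fin N × G → ℂ),
        α * ∑ p ∈ s, ‖c p‖ ^ 2 ≤ ‖∑ p ∈ s, c p • π (Multiplicative.ofAdd p.2) (φ p.1)‖ ^ 2 := by
  have h := ae_posSemidef_smul_gramAt_add_iff π φ hA 1 (-α)
  have h1 : (∀ᵐ ξ ∂(haar G), α ≤ lamMin (gramAt π φ hA ξ)) ↔
      ∀ᵐ ξ ∂(haar G), (((1 : ℝ) : ℂ) • gramAt π φ hA ξ + ((-α : ℝ) : ℂ) • 1).PosSemidef := by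
    refine Filter.eventually_congr ?_
    filter_upwards [ae_posSemidef_gramAt π φ hA] with ξ hξ
    rw [le_lamMin_iff hN hξ.1, sub_eq_add_neg]
    simp
  rw [h1, h]
  refine forall₂_congr fun s c => ?_
  rw [one_mul, neg_mul, ← sub_eq_add_neg, sub_nonneg]

end Finite

/-! ### From finite sums to ℓ² series -/

section Series

variable {G : Type*} [AddCommGroup G] {H : Type*} [NormedAddCommGroup H] [InnerProductSpace ℂ H]
  {π : Multiplicative G →* (H ≃ₗᵢ[ℂ] H)} {N : ℕ} {φ : Fin N → H}

theorem hasSum_norm_sq_coeff {G : Type*} (x : ell2N N G) :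
    HasSum (fun p : Fin N × G => ‖x p.1 p.2‖ ^ 2) (‖x‖ ^ 2) := by
  have h : ∀ n, HasSum (fun g => ‖x n g‖ ^ 2) (‖x n‖ ^ 2) := fun n => by
    simpa using lp.hasSum_norm (p := 2) (by simp) (x n)
  rw [PiLp.norm_sq_eq_of_L2]
  have hs : Summable (fun p : Fin N × G => ‖x p.1 p.2‖ ^ 2) := by
    rw [summable_prod_of_nonneg fun p => by positivity]
    exact ⟨fun n => (h n).summable, Summable.of_finite⟩
  have h2 := hs.hasSum.prod_fiberwise fun n => h n
  exact (hasSum_fintype _).unique h2 ▸ hs.hasSum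

/-- Every finitely supported family of coefficients comes from an element of `ℓ²_N(G)`. -/
theorem exists_ell2N_of_finset {G : Type*} (s : Finset (Fin N × G)) (c : Fin N × G → ℂ) :
    ∃ x : ell2N N G, (∀ p ∈ s, x p.1 p.2 = c p) ∧ ∀ p ∉ s, x p.1 p.2 = 0 := by
  classical
  have hmem : ∀ n, Memℓp (fun g => if (n, g) ∈ s then c (n, g) else 0) 2 := fun n => by
    refine memℓp_gen (summable_of_ne_finset_zero (s := s.image Prod.snd) fun g hg => ?_)
    rw [if_neg fun h => hg (Finset.mem_image_of_mem Prod.snd h)]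
    simp
  refine ⟨WithLp.toLp 2 fun n => ⟨_, hmem n⟩, fun p hp => ?_, fun p hp => ?_⟩
  · exact if_pos hp
  · exact if_neg hp

theorem tsum_synthTerm_of_finset {s : Finset (Fin N × G)} {c : Fin N × G → ℂ} {x : ell2N N G}
    (h1 : ∀ p ∈ s, x p.1 p.2 = c p) (h2 : ∀ p ∉ s, x p.1 p.2 = 0) :
    ∑' p, synthTerm π φ x p = ∑ p ∈ s, c p • π (Multiplicative.ofAdd p.2) (φ p.1) := by
  rw [tsum_eq_sum (s := s) fun p hp => by rw [synthTerm, h2 p hp, zero_smul]]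
  exact Finset.sum_congr rfl fun p hp => by rw [synthTerm, h1 p hp]

theorem norm_sq_of_finset {G : Type*} {s : Finset (Fin N × G)} {c : Fin N × G → ℂ} {x : ell2N N G}
    (h1 : ∀ p ∈ s, x p.1 p.2 = c p) (h2 : ∀ p ∉ s, x p.1 p.2 = 0) :
    ‖x‖ ^ 2 = ∑ p ∈ s, ‖c p‖ ^ 2 := by
  rw [← (hasSum_norm_sq_coeff x).tsum_eq, tsum_eq_sum (s := s) fun p hp => by simp [h2 p hp]]
  exact Finset.sum_congr rfl fun p hp => by rw [h1 p hp]

/-- The finite estimate, applied to blocks far out in the index set, is the Cauchy criterion for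
unconditional convergence. -/
theorem summable_synthTerm [CompleteSpace H] {β : ℝ}
    (h : ∀ (s : Finset (Fin N × G)) (c : Fin N × G → ℂ),
      ‖∑ p ∈ s, c p • π (Multiplicative.ofAdd p.2) (φ p.1)‖ ^ 2 ≤ β * ∑ p ∈ s, ‖c p‖ ^ 2)
    (x : ell2N N G) : Summable (synthTerm π φ x) := by
  rw [summable_iff_vanishing_norm]
  intro ε hε
  obtain ⟨s, hs⟩ := summable_iff_vanishing_norm.1 (hasSum_norm_sq_coeff x).summable
    -- `|β| + 1` replaces `β`, whose sign is unknown, to have a positive divisor.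
    (ε ^ 2 / (|β| + 1)) (by positivity)
  refine ⟨s, fun t ht => ?_⟩
  have h1 := hs t ht
  rw [Real.norm_of_nonneg (Finset.sum_nonneg fun _ _ => by positivity),
    lt_div_iff₀ (by positivity)] at h1
  refine (sq_lt_sq₀ (norm_nonneg _) hε.le).1 ?_
  have h0 : 0 ≤ ∑ p ∈ t, ‖x p.1 p.2‖ ^ 2 := Finset.sum_nonneg fun _ _ => by positivity
  calc ‖∑ p ∈ t, synthTerm π φ x p‖ ^ 2 ≤ β * ∑ p ∈ t, ‖x p.1 p.2‖ ^ 2 :=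
        h t fun p => x p.1 p.2
    _ ≤ (|β| + 1) * ∑ p ∈ t, ‖x p.1 p.2‖ ^ 2 := by
        gcongr
        exact (le_abs_self β).trans (by linarith)
    _ < ε ^ 2 := by rwa [mul_comm]

theorem tendsto_norm_sq_sum {x : ell2N N G} (hx : Summable (synthTerm π φ x)) :
    Filter.Tendsto (fun s : Finset (Fin N × G) =>
      ‖∑ p ∈ s, x p.1 p.2 • π (Multiplicative.ofAdd p.2) (φ p.1)‖ ^ 2) Filter.atTop
      (nhds (‖∑' p, synthTerm π φ x p‖ ^ 2)) :=
  (hx.hasSum.norm).pow 2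

theorem isBesselBound_iff_finset [CompleteSpace H] {β : ℝ} :
    IsBesselBound π φ β ↔ ∀ (s : Finset (Fin N × G)) (c : Fin N × G → ℂ),
      ‖∑ p ∈ s, c p • π (Multiplicative.ofAdd p.2) (φ p.1)‖ ^ 2 ≤ β * ∑ p ∈ s, ‖c p‖ ^ 2 := by
  constructor
  · intro h s c
    obtain ⟨x, h1, h2⟩ := exists_ell2N_of_finset s c
    rw [← tsum_synthTerm_of_finset h1 h2, ← norm_sq_of_finset h1 h2]
    exact (h x).2
  · intro h x
    have hx := summable_synthTerm h x
    exact ⟨hx, le_of_tendsto_of_tendsto' (tendsto_norm_sq_sum hx)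
      (Filter.Tendsto.const_mul β (hasSum_norm_sq_coeff x)) fun s => h s fun p => x p.1 p.2⟩

theorem areRieszBounds_iff_finset [CompleteSpace H] {α β : ℝ} :
    AreRieszBounds π φ α β ↔ 0 < α ∧ α ≤ β ∧ IsBesselBound π φ β ∧
      ∀ (s : Finset (Fin N × G)) (c : Fin N × G → ℂ),
        α * ∑ p ∈ s, ‖c p‖ ^ 2 ≤
          ‖∑ p ∈ s, c p • π (Multiplicative.ofAdd p.2) (φ p.1)‖ ^ 2 := by
  constructor
  · rintro ⟨h0, hαβ, h⟩
    refine ⟨h0, hαβ, fun x => ⟨(h x).1, (h x).2.2⟩, fun s c => ?_⟩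
    obtain ⟨x, h1, h2⟩ := exists_ell2N_of_finset s c
    rw [← tsum_synthTerm_of_finset h1 h2, ← norm_sq_of_finset h1 h2]
    exact (h x).2.1
  · rintro ⟨h0, hαβ, hB, h⟩
    exact ⟨h0, hαβ, fun x => ⟨(hB x).1, le_of_tendsto_of_tendsto'
      (Filter.Tendsto.const_mul α (hasSum_norm_sq_coeff x)) (tendsto_norm_sq_sum (hB x).1)
      fun s => h s fun p => x p.1 p.2, (hB x).2⟩⟩

end Series

/-! ### Essential bounds of real functions -/

section EssSup

variable {X : Type*} [MeasurableSpace X] {μ : Measure X} [NeZero μ] {f : X → ℝ}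

/-- In ℝ the essential supremum is meaningful only if the set of a.e. upper bounds is nonempty
(`hb`) and bounded below (`ha`, with μ nonzero). -/
theorem isLeast_essSup {a b : ℝ} (ha : ∀ᵐ x ∂μ, a ≤ f x) (hb : ∀ᵐ x ∂μ, f x ≤ b) :
    IsLeast {β : ℝ | ∀ᵐ x ∂μ, f x ≤ β} (essSup f μ) := by
  have hbdd : Filter.IsBoundedUnder (· ≥ ·) (ae μ) f := ⟨a, ha⟩
  exact ⟨ae_le_essSup ⟨b, hb⟩,
    fun β hβ => essSup_le_of_ae_le β hβ hbdd.isCoboundedUnder_le⟩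

theorem isGreatest_essInf {a b : ℝ} (ha : ∀ᵐ x ∂μ, a ≤ f x) (hb : ∀ᵐ x ∂μ, f x ≤ b) :
    IsGreatest {α : ℝ | ∀ᵐ x ∂μ, α ≤ f x} (essInf f μ) := by
  have hbdd : Filter.IsBoundedUnder (· ≤ ·) (ae μ) f := ⟨b, hb⟩
  exact ⟨ae_essInf_le ⟨a, ha⟩,
    fun α hα => le_essInf_of_ae_le α hα hbdd.isCoboundedUnder_ge⟩

end EssSup

theorem exists_forall_ae_norm_le {ι X E : Type*} [Finite ι] [MeasurableSpace X] {μ : Measure X}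
    [NormedAddCommGroup E] {f : ι → X → E} (h : ∀ i, MemLp (f i) ∞ μ) :
    ∃ c : ℝ, ∀ᵐ x ∂μ, ∀ i, ‖f i x‖ ≤ c := by
  have := Fintype.ofFinite ι
  refine ⟨∑ i, (eLpNorm (f i) ∞ μ).toReal, ae_all_iff.2 fun i => ?_⟩
  have hb := ae_le_eLpNormEssSup (f := f i) (μ := μ)
  filter_upwards [hb] with x hx
  rw [← eLpNorm_exponent_top] at hx
  have h1 : ‖f i x‖ ≤ (eLpNorm (f i) ∞ μ).toReal := by
    rw [← toReal_enorm]
    exact ENNReal.toReal_mono (h i).2.ne hx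
  exact h1.trans (Finset.single_le_sum (f := fun i => (eLpNorm (f i) ∞ μ).toReal)
    (fun _ _ => ENNReal.toReal_nonneg) (Finset.mem_univ i))

/-! ### Bessel and Riesz bounds in terms of the Gram matrix -/

section Bounds

variable {G : Type*} [AddCommGroup G] [TopologicalSpace G] [DiscreteTopology G]
  {H : Type*} [NormedAddCommGroup H] [InnerProductSpace ℂ H]
  (π : Multiplicative G →* (H ≃ₗᵢ[ℂ] H)) {N : ℕ} (φ : Fin N → H) (hA : CorrMemEll2 π φ)

theorem gramMemLinfty_iff_exists_ae_lamMax_le (hN : 0 < N) :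
    GramMemLinfty π φ hA ↔ ∃ β : ℝ, ∀ᵐ ξ ∂(haar G), lamMax (gramAt π φ hA ξ) ≤ β := by
  constructor
  · intro h
    obtain ⟨c, hc⟩ := exists_forall_ae_norm_le fun i => h i i
    refine ⟨N * c, ?_⟩
    filter_upwards [hc, ae_posSemidef_gramAt π φ hA] with ξ h1 h2
    exact lamMax_le_of_norm_entry_le hN h2 h1
  · rintro ⟨β, hβ⟩ m n
    refine memLp_top_of_bound (Lp.memLp (gram π φ hA m n)).1 β ?_
    filter_upwards [hβ, ae_posSemidef_gramAt π φ hA] with ξ h1 h2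
    exact norm_entry_le_of_posSemidef_sub h2 ((lamMax_le_iff hN h2.1 β).1 h1) m n

theorem ae_lamMin_le_lamMax (hN : 0 < N) :
    ∀ᵐ ξ ∂(haar G), lamMin (gramAt π φ hA ξ) ≤ lamMax (gramAt π φ hA ξ) := by
  filter_upwards [ae_posSemidef_gramAt π φ hA] with ξ hξ
  exact lamMin_le_lamMax hN hξ.1

variable [CompleteSpace H]

theorem isBesselBound_iff_ae_lamMax_le (hN : 0 < N) (β : ℝ) :
    IsBesselBound π φ β ↔ ∀ᵐ ξ ∂(haar G), lamMax (gramAt π φ hA ξ) ≤ β :=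
  isBesselBound_iff_finset.trans (ae_lamMax_le_iff π φ hA hN β).symm

theorem areRieszBounds_iff_ae (hN : 0 < N) (α β : ℝ) :
    AreRieszBounds π φ α β ↔ 0 < α ∧ α ≤ β ∧
      (∀ᵐ ξ ∂(haar G), lamMax (gramAt π φ hA ξ) ≤ β) ∧
      ∀ᵐ ξ ∂(haar G), α ≤ lamMin (gramAt π φ hA ξ) := by
  rw [areRieszBounds_iff_finset, isBesselBound_iff_ae_lamMax_le π φ hA hN,
    ae_le_lamMin_iff π φ hA hN]

theorem isLeast_besselBound (hN : 0 < N) (h : IsBesselSequence π φ) :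
    IsLeast {β : ℝ | IsBesselBound π φ β}
      (essSup (fun ξ => lamMax (gramAt π φ hA ξ)) (haar G)) := by
  obtain ⟨β, hβ⟩ := h
  simp only [isBesselBound_iff_ae_lamMax_le π φ hA hN] at hβ ⊢
  refine isLeast_essSup (a := 0) ?_ hβ
  filter_upwards [ae_posSemidef_gramAt π φ hA] with ξ hξ
  exact lamMax_nonneg hN hξ

theorem isRieszSequence_iff (hN : 0 < N) :
    IsRieszSequence π φ ↔ GramMemLinfty π φ hA ∧
      0 < essInf (fun ξ => (gramAt π φ hA ξ).det.re) (haar G) := by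
  have hpsd := ae_posSemidef_gramAt π φ hA
  have hdet0 : ∀ᵐ ξ ∂(haar G), 0 ≤ (gramAt π φ hA ξ).det.re := by
    filter_upwards [hpsd] with ξ hξ
    exact (Complex.nonneg_iff.1 hξ.det_nonneg).1
  -- An a.e. upper bound on the determinant is needed for its real-valued `essInf` to be a genuine
  -- greatest lower bound.
  have hdet {β : ℝ} (hβ : ∀ᵐ ξ ∂(haar G), lamMax (gramAt π φ hA ξ) ≤ β) :
      ∀ᵐ ξ ∂(haar G), (gramAt π φ hA ξ).det.re ≤ β ^ N := by
    filter_upwards [hpsd, hβ] with ξ h1 h2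
    exact det_re_le_pow h1 h2
  constructor
  · rintro ⟨α, β, h⟩
    obtain ⟨h0, -, hβ, hα⟩ := (areRieszBounds_iff_ae π φ hA hN α β).1 h
    refine ⟨(gramMemLinfty_iff_exists_ae_lamMax_le π φ hA hN).2 ⟨β, hβ⟩, ?_⟩
    refine (pow_pos h0 N).trans_le ((isGreatest_essInf hdet0 (hdet hβ)).2 ?_)
    filter_upwards [hpsd, hα] with ξ h1 h2
    exact pow_le_det_re h1.1 h0.le h2
  · rintro ⟨hG, hpos⟩
    obtain ⟨b, hb⟩ := (gramMemLinfty_iff_exists_ae_lamMax_le π φ hA hN).1 hG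
    -- The maximum with 1 makes the bound positive, so its power can be divided by.
    have hβ : ∀ᵐ ξ ∂(haar G), lamMax (gramAt π φ hA ξ) ≤ max b 1 :=
      hb.mono fun ξ h => h.trans (le_max_left _ _)
    have hβ0 : 0 < max b 1 := lt_max_of_lt_right one_pos
    have hα : ∀ᵐ ξ ∂(haar G), essInf (fun ξ => (gramAt π φ hA ξ).det.re) (haar G) /
        max b 1 ^ (N - 1) ≤ lamMin (gramAt π φ hA ξ) := by
      filter_upwards [hpsd, hβ, (isGreatest_essInf hdet0 (hdet hβ)).1] with ξ h1 h2 h3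
      exact div_le_lamMin hN h1 hβ0 h2 h3
    -- The required inequality α ≤ β between the constants is read off at a single point, which
    -- exists since the measure is nonzero.
    obtain ⟨ξ, h1, h2, h3⟩ := (hα.and (hβ.and (ae_lamMin_le_lamMax π φ hA hN))).exists
    exact ⟨_, _, (areRieszBounds_iff_ae π φ hA hN _ _).2
      ⟨div_pos hpos (pow_pos hβ0 _), h1.trans (h3.trans h2), hβ, hα⟩⟩

theorem isGreatest_isLeast_rieszBounds (hN : 0 < N) (h : IsRieszSequence π φ) :
    IsGreatest {α : ℝ | ∃ β : ℝ, AreRieszBounds π φ α β}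
        (essInf (fun ξ => lamMin (gramAt π φ hA ξ)) (haar G)) ∧
      IsLeast {β : ℝ | ∃ α : ℝ, AreRieszBounds π φ α β}
        (essSup (fun ξ => lamMax (gramAt π φ hA ξ)) (haar G)) := by
  obtain ⟨α, β, h⟩ := h
  simp only [areRieszBounds_iff_ae π φ hA hN] at h ⊢
  obtain ⟨h0, -, hβ, hα⟩ := h
  have hle := ae_lamMin_le_lamMax π φ hA hN
  have hG := isGreatest_essInf hα ((hle.and hβ).mono fun ξ h => h.1.trans h.2)
  have hL := isLeast_essSup ((hle.and hα).mono fun ξ h => h.2.trans h.1) hβ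
  -- The two essential bounds themselves form a pair of Riesz bounds, so both optima are attained by
  -- this one pair.
  have hpos := h0.trans_le (hG.2 hα)
  obtain ⟨ξ, h1, h2, h3⟩ := ((show ∀ᵐ _ ∂_, _ from hG.1).and
    ((show ∀ᵐ _ ∂_, _ from hL.1).and hle)).exists
  have hmin_le_max := h1.trans (h3.trans h2)
  exact ⟨⟨⟨_, hpos, hmin_le_max, hL.1, hG.1⟩, fun α' ⟨_, _, _, _, h'⟩ => hG.2 h'⟩,
    ⟨⟨_, hpos, hmin_le_max, hL.1, hG.1⟩, fun β' ⟨_, _, _, h', _⟩ => hL.2 h'⟩⟩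

end Bounds

end GroupRiesz

end

theorem theorem4p2
    {G : Type*} [AddCommGroup G] [TopologicalSpace G] [DiscreteTopology G]
    {H : Type*} [NormedAddCommGroup H] [InnerProductSpace ℂ H] [CompleteSpace H]
    [TopologicalSpace.SeparableSpace H]
    (π : Multiplicative G →* (H ≃ₗᵢ[ℂ] H))
    (N : ℕ) (hN : 0 < N) (φ : Fin N → H)
    (hA : GroupRiesz.CorrMemEll2 π φ) :
    -- (a)
    ((GroupRiesz.IsBesselSequence π φ ↔ GroupRiesz.GramMemLinfty π φ hA) ∧
      (GroupRiesz.IsBesselSequence π φ →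
        (∀ᵐ ξ ∂(GroupRiesz.haar G), (GroupRiesz.gramAt π φ hA ξ).PosSemidef) ∧
        IsLeast {β : ℝ | GroupRiesz.IsBesselBound π φ β}
          (essSup (fun ξ => GroupRiesz.lamMax (GroupRiesz.gramAt π φ hA ξ))
            (GroupRiesz.haar G)))) ∧
    -- (b)
    ((GroupRiesz.IsRieszSequence π φ ↔
        GroupRiesz.GramMemLinfty π φ hA ∧
        0 < essInf (fun ξ => (GroupRiesz.gramAt π φ hA ξ).det.re) (GroupRiesz.haar G)) ∧
      (GroupRiesz.IsRieszSequence π φ →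
        IsGreatest {α : ℝ | ∃ β : ℝ, GroupRiesz.AreRieszBounds π φ α β}
          (essInf (fun ξ => GroupRiesz.lamMin (GroupRiesz.gramAt π φ hA ξ))
            (GroupRiesz.haar G)) ∧
        IsLeast {β : ℝ | ∃ α : ℝ, GroupRiesz.AreRieszBounds π φ α β}
          (essSup (fun ξ => GroupRiesz.lamMax (GroupRiesz.gramAt π φ hA ξ))
            (GroupRiesz.haar G)))) := by
  have hBessel : GroupRiesz.IsBesselSequence π φ ↔ GroupRiesz.GramMemLinfty π φ hA :=
    (exists_congr fun β => GroupRiesz.isBesselBound_iff_ae_lamMax_le π φ hA hN β).trans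
      (GroupRiesz.gramMemLinfty_iff_exists_ae_lamMax_le π φ hA hN).symm
  exact ⟨⟨hBessel, fun h => ⟨GroupRiesz.ae_posSemidef_gramAt π φ hA,
      GroupRiesz.isLeast_besselBound π φ hA hN h⟩⟩,
    GroupRiesz.isRieszSequence_iff π φ hA hN,
    GroupRiesz.isGreatest_isLeast_rieszBounds π φ hA hN⟩
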